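/- Let $\mathbb{F}$ be a field of characteristic zero, let $q\in\mathbb{F}$ be nonzero and not a root of unity, and let $s\in\mathbb{F}$ be nonzero. For $a,b\in\mathbb{F}$ let $\mathcal{U}_q(a,b)$ be the unital associative $\mathbb{F}$-algebra with generators $A$, $B$ and the single relation $AB-qBA=aA+bB$; put $C:=AB-BA$ in it, and regard it as a Lie algebra under $[X,Y]=XY-YX$. Let $\mathcal{L}_{(s,0)}$ be the Lie subalgebra of $\mathcal{U}_q(s,0)$ generated by $A$ and $B$, and let $\widetilde{\mathcal{K}}$ be the linear span in $\mathcal{U}_q(0,s)$ of the elements $A$, $B$, $B^nC^m$, $C^mA^k$ ($m,k\ge 1$, $n\ge 0$). Then the elements $A$, $B$, $B^nC^m$, $C^mA^k$ ($m,k\ge 1$, $n\ge 0$) of $\mathcal{U}_q(s,0)$ lie in $\mathcal{L}_{(s,0)}$ and span it, $\widetilde{\mathcal{K}}$ is a Lie subalgebra of $\mathcal{U}_q(0,s)$, there is exactly one linear map $\Psi:\mathcal{L}_{(s,0)}\to\widetilde{\mathcal{K}}$ with $$A\mapsto -B,\quad B\mapsto -A,\quad C^n\mapsto -C^n,\quad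 C^uA^v\mapsto -B^vC^u,\quad B^vC^u\mapsto -C^uA^v\qquad(n,u,v\ge 1),$$ and $\Psi$ is an isomorphism of Lie algebras. -/

import Mathlib

namespace QDeformed

/-- The two letters. -/
inductive Letter : Type
  | A
  | B

/-- The single defining relation `AB - qBA = rA + sB`, on the free (unital associative) algebra
on the two letters. -/
inductive Rel {F : Type*} [Field F] (q r s : F) :
    FreeAlgebra F Letter → FreeAlgebra F Letter → Prop
  | rel : Rel q r s
      (FreeAlgebra.ι F Letter.A * FreeAlgebra.ι F Letter.B
        - q • (FreeAlgebra.ι F Letter.B * FreeAlgebra.ι F Letter.A))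
      (r • FreeAlgebra.ι F Letter.A + s • FreeAlgebra.ι F Letter.B)

/-- The algebra `U_q(r, s)` with generators `A`, `B` and relation `AB - qBA = rA + sB`. As an
associative algebra it carries the commutator bracket `⁅X, Y⁆ = XY - YX`. -/
abbrev U {F : Type*} [Field F] (q r s : F) : Type _ := RingQuot (Rel q r s)

/-- The Lie ring structure of `U_q(r, s)`, given by the commutator. -/
noncomputable instance instLieRingU {F : Type*} [Field F] (q r s : F) : LieRing (U q r s) :=
  LieRing.ofAssociativeRing

/-- The Lie algebra structure of `U_q(r, s)`, given by the commutator. -/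
noncomputable instance instLieAlgebraU {F : Type*} [Field F] (q r s : F) : LieAlgebra F (U q r s) :=
  LieAlgebra.ofAssociativeAlgebra

/-- The generator `A` of `U_q(r, s)`. -/
noncomputable def gA {F : Type*} [Field F] (q r s : F) : U q r s :=
  RingQuot.mkAlgHom F (Rel q r s) (FreeAlgebra.ι F Letter.A)

/-- The generator `B` of `U_q(r, s)`. -/
noncomputable def gB {F : Type*} [Field F] (q r s : F) : U q r s :=
  RingQuot.mkAlgHom F (Rel q r s) (FreeAlgebra.ι F Letter.B)

/-- The element `C = AB - BA` of `U_q(r, s)`. -/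
noncomputable def gC {F : Type*} [Field F] (q r s : F) : U q r s :=
  gA q r s * gB q r s - gB q r s * gA q r s

/-- The Lie subalgebra `L_(r,s)` of `U_q(r, s)` generated by `A` and `B`, that is, the set of all
Lie polynomials in `A`, `B`. -/
noncomputable def lieL {F : Type*} [Field F] (q r s : F) : LieSubalgebra F (U q r s) :=
  LieSubalgebra.lieSpan F (U q r s) {gA q r s, gB q r s}

/-- The elements `A`, `B`, `B^n C^m`, `C^m A^k` of `U_q(r, s)`, for `m, k ≥ 1` and `n ≥ 0`. -/
noncomputable def lieWords {F : Type*} [Field F] (q r s : F) : Set (U q r s) :=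
  {gA q r s, gB q r s}
    ∪ {X | ∃ n m : ℕ, 1 ≤ m ∧ X = gB q r s ^ n * gC q r s ^ m}
    ∪ {X | ∃ m k : ℕ, 1 ≤ m ∧ 1 ≤ k ∧ X = gC q r s ^ m * gA q r s ^ k}

/-- The linear span of `A`, `B`, `B^n C^m`, `C^m A^k` in `U_q(r, s)`. -/
noncomputable def wordSpan {F : Type*} [Field F] (q r s : F) : Submodule F (U q r s) :=
  Submodule.span F (lieWords q r s)

/-- The linear map `Ψ`, from `L_(s,0)` to a Lie subalgebra `K` of `U_q(0, s)`, takes the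
prescribed values
`A ↦ -B`, `B ↦ -A`, `C^n ↦ -C^n`, `C^u A^v ↦ -B^v C^u`, `B^v C^u ↦ -C^u A^v` (`n, u, v ≥ 1`).
A value is prescribed at each member of `L_(s,0)` which is one of these words. -/
structure HasPsiValues {F : Type*} [Field F] {q s : F} {K : LieSubalgebra F (U q 0 s)}
    (Ψ : lieL q s 0 →ₗ[F] K) : Prop where
  map_A : ∀ x : lieL q s 0, (x : U q s 0) = gA q s 0 → (Ψ x : U q 0 s) = -gB q 0 s
  map_B : ∀ x : lieL q s 0, (x : U q s 0) = gB q s 0 → (Ψ x : U q 0 s) = -gA q 0 s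
  map_C : ∀ n : ℕ, 1 ≤ n → ∀ x : lieL q s 0, (x : U q s 0) = gC q s 0 ^ n →
    (Ψ x : U q 0 s) = -gC q 0 s ^ n
  map_CA : ∀ u v : ℕ, 1 ≤ u → 1 ≤ v → ∀ x : lieL q s 0,
    (x : U q s 0) = gC q s 0 ^ u * gA q s 0 ^ v →
    (Ψ x : U q 0 s) = -(gB q 0 s ^ v * gC q 0 s ^ u)
  map_BC : ∀ u v : ℕ, 1 ≤ u → 1 ≤ v → ∀ x : lieL q s 0,
    (x : U q s 0) = gB q s 0 ^ v * gC q s 0 ^ u →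
    (Ψ x : U q 0 s) = -(gC q 0 s ^ u * gA q 0 s ^ v)

end QDeformed

/-!
`Ψ` is the negative of an anti-isomorphism. Reversing products while exchanging `A` and `B` turns
the relation `AB - qBA = rA + sB` into `AB - qBA = sA + rB`, so it defines an involutive
anti-isomorphism `swap : U_q(r, s) → U_q(s, r)`, which fixes `C`. The negative of an
anti-isomorphism of associative algebras is an isomorphism of the commutator Lie algebras
(`negSwap`), and on words it has exactly the prescribed values; it carries the spanning words of
`U_q(s, 0)` to those of `U_q(0, s)` up to sign. Everything therefore follows from the equality of
`L_(s,0)` with the span of the words in `U_q(s, 0)`.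

For that equality put `T = (q - 1)B + s`. Then `AT = qTA` and `C = TA`, so that `U_q(s, 0)` is a
quantum plane in `A` and `T`, and `C ^ m` is a nonzero multiple of `T ^ m * A ^ m`. Hence the words
other than `A` and `B` span the space of the monomials `T ^ i * A ^ j` with `i, j ≥ 1`
(`quantumIdeal`), which is stable under multiplication by `A` and `B` on either side and contains
`⁅A, B⁆ = C`: the span of the words is closed under the bracket (`lie_mem_wordSpan`).
Conversely, bracketing `T ^ i * A ^ j` with `T` and with `A` raises the exponent `i`, respectively
`j`, up to a factor `1 - q ^ j` or `q ^ i - 1`. These factors are nonzero, so all these monomials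
are reached from `TA = ⁅A, B⁆` (`quantumIdeal_le_lieL`).
-/

namespace QDeformed

/-! ### Monomials in a quantum plane -/

section QuantumPlane

variable {F R : Type*} [Field F] [Ring R] [Algebra F R] {q : F} {a t : R}

theorem pow_mul_of_qcomm (h : a * t = q • (t * a)) (j : ℕ) :
    a ^ j * t = q ^ j • (t * a ^ j) := by
  induction j with
  | zero => simp
  | succ j ih =>
    rw [pow_succ, mul_assoc, h, mul_smul_comm, ← mul_assoc, ih, smul_mul_assoc, smul_smul,
      mul_assoc, pow_succ' q]

theorem pow_mul_pow_of_qcomm (h : a * t = q • (t * a)) (j k : ℕ) :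
    a ^ j * t ^ k = q ^ (j * k) • (t ^ k * a ^ j) := by
  induction k with
  | zero => simp
  | succ k ih =>
    rw [pow_succ, ← mul_assoc, ih, smul_mul_assoc, mul_assoc, pow_mul_of_qcomm h, mul_smul_comm,
      smul_smul, ← mul_assoc, mul_add_one, pow_add]

theorem monomial_mul_monomial (h : a * t = q • (t * a)) (i j k l : ℕ) :
    (t ^ i * a ^ j) * (t ^ k * a ^ l) = q ^ (j * k) • (t ^ (i + k) * a ^ (j + l)) := by
  rw [mul_assoc, ← mul_assoc (a ^ j), pow_mul_pow_of_qcomm h, smul_mul_assoc, mul_smul_comm,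
    pow_add, pow_add]
  simp only [mul_assoc]

theorem mul_pow_of_qcomm (hq0 : q ≠ 0) (h : a * t = q • (t * a)) (m : ℕ) :
    ∃ c : F, c ≠ 0 ∧ (t * a) ^ m = c • (t ^ m * a ^ m) := by
  induction m with
  | zero => exact ⟨1, one_ne_zero, by simp⟩
  | succ m ih =>
    obtain ⟨c, hc, e⟩ := ih
    refine ⟨c * q ^ m, mul_ne_zero hc (pow_ne_zero _ hq0), ?_⟩
    have := monomial_mul_monomial h m m 1 1
    simp only [pow_one, mul_one] at this
    rw [pow_succ, e, smul_mul_assoc, this, smul_smul]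

variable (F a t) in
/-- The linear span of the monomials `t ^ i * a ^ j` with `i, j ≥ 1`. When `t` and `a`
`q`-commute and generate the algebra, this is the two-sided ideal generated by `t * a`. -/
def quantumIdeal : Submodule F R :=
  Submodule.span F {x | ∃ i j : ℕ, 1 ≤ i ∧ 1 ≤ j ∧ x = t ^ i * a ^ j}

theorem monomial_mem {i j : ℕ} (hi : 1 ≤ i) (hj : 1 ≤ j) :
    t ^ i * a ^ j ∈ quantumIdeal F a t :=
  Submodule.subset_span ⟨i, j, hi, hj, rfl⟩

theorem monomial_mul_mem (h : a * t = q • (t * a)) (k l : ℕ) {x : R}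
    (hx : x ∈ quantumIdeal F a t) : (t ^ k * a ^ l) * x ∈ quantumIdeal F a t := by
  induction hx using Submodule.span_induction with
  | mem x hx =>
    obtain ⟨i, j, hi, hj, rfl⟩ := hx
    rw [monomial_mul_monomial h]
    exact Submodule.smul_mem _ _ (monomial_mem (by lia) (by lia))
  | zero => simp
  | add x y _ _ ihx ihy => rw [mul_add]; exact add_mem ihx ihy
  | smul c x _ ih => rw [mul_smul_comm]; exact Submodule.smul_mem _ _ ih

theorem mul_monomial_mem (h : a * t = q • (t * a)) (k l : ℕ) {x : R}
    (hx : x ∈ quantumIdeal F a t) : x * (t ^ k * a ^ l) ∈ quantumIdeal F a t := by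
  induction hx using Submodule.span_induction with
  | mem x hx =>
    obtain ⟨i, j, hi, hj, rfl⟩ := hx
    rw [monomial_mul_monomial h]
    exact Submodule.smul_mem _ _ (monomial_mem (by lia) (by lia))
  | zero => simp
  | add x y _ _ ihx ihy => rw [add_mul]; exact add_mem ihx ihy
  | smul c x _ ih => rw [smul_mul_assoc]; exact Submodule.smul_mem _ _ ih

theorem quantumIdeal_mul_mem (h : a * t = q • (t * a)) {x y : R}
    (hx : x ∈ quantumIdeal F a t) (hy : y ∈ quantumIdeal F a t) :
    x * y ∈ quantumIdeal F a t := by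
  induction hy using Submodule.span_induction with
  | mem y hy =>
    obtain ⟨i, j, -, -, rfl⟩ := hy
    exact mul_monomial_mem h i j hx
  | zero => simp
  | add y z _ _ ihy ihz => rw [mul_add]; exact add_mem ihy ihz
  | smul c y _ ih => rw [mul_smul_comm]; exact Submodule.smul_mem _ _ ih

end QuantumPlane

/-! ### The span of the words in `U_q(s, 0)` -/

section Words

variable {F : Type*} [Field F] {q s : F}

theorem gA_mul_gB (q r s : F) :
    gA q r s * gB q r s - q • (gB q r s * gA q r s) = r • gA q r s + s • gB q r s := by
  simpa [gA, gB] using RingQuot.mkAlgHom_rel F (Rel.rel (q := q) (r := r) (s := s))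

/-- The element `T = (q - 1)B + s` of `U_q(s, 0)`, which `q`-commutes with `A`. -/
noncomputable def gT (q s : F) : U q s 0 :=
  (q - 1) • gB q s 0 + s • 1

theorem gA_mul_gB_eq : gA q s 0 * gB q s 0 = q • (gB q s 0 * gA q s 0) + s • gA q s 0 := by
  have h := gA_mul_gB q s 0
  rw [zero_smul, add_zero, sub_eq_iff_eq_add] at h
  rw [h, add_comm]

theorem gA_mul_gT : gA q s 0 * gT q s = q • (gT q s * gA q s 0) := by
  simp only [gT, mul_add, add_mul, mul_smul_comm, smul_mul_assoc, mul_one, one_mul, gA_mul_gB_eq]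
  module

theorem gC_eq : gC q s 0 = gT q s * gA q s 0 := by
  simp only [gC, gT, add_mul, smul_mul_assoc, one_mul, gA_mul_gB_eq]
  module

theorem gB_eq (hq1 : q - 1 ≠ 0) : gB q s 0 = (q - 1)⁻¹ • (gT q s - s • 1) := by
  rw [gT, add_sub_cancel_right, inv_smul_smul₀ hq1]

theorem gC_pow (hq0 : q ≠ 0) (m : ℕ) :
    ∃ c : F, c ≠ 0 ∧ gC q s 0 ^ m = c • (gT q s ^ m * gA q s 0 ^ m) := by
  rw [gC_eq]
  exact mul_pow_of_qcomm hq0 gA_mul_gT m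

theorem gA_mul_mem {x : U q s 0} (hx : x ∈ quantumIdeal F (gA q s 0) (gT q s)) :
    gA q s 0 * x ∈ quantumIdeal F (gA q s 0) (gT q s) := by
  simpa using monomial_mul_mem gA_mul_gT 0 1 hx

theorem mul_gA_mem {x : U q s 0} (hx : x ∈ quantumIdeal F (gA q s 0) (gT q s)) :
    x * gA q s 0 ∈ quantumIdeal F (gA q s 0) (gT q s) := by
  simpa using mul_monomial_mem gA_mul_gT 0 1 hx

theorem gB_mul_mem (hq1 : q - 1 ≠ 0) {x : U q s 0}
    (hx : x ∈ quantumIdeal F (gA q s 0) (gT q s)) :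
    gB q s 0 * x ∈ quantumIdeal F (gA q s 0) (gT q s) := by
  rw [gB_eq hq1, smul_mul_assoc, sub_mul, smul_mul_assoc, one_mul]
  refine Submodule.smul_mem _ _ (sub_mem ?_ (Submodule.smul_mem _ _ hx))
  simpa using monomial_mul_mem gA_mul_gT 1 0 hx

theorem mul_gB_mem (hq1 : q - 1 ≠ 0) {x : U q s 0}
    (hx : x ∈ quantumIdeal F (gA q s 0) (gT q s)) :
    x * gB q s 0 ∈ quantumIdeal F (gA q s 0) (gT q s) := by
  rw [gB_eq hq1, mul_smul_comm, mul_sub, mul_smul_comm, mul_one]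
  refine Submodule.smul_mem _ _ (sub_mem ?_ (Submodule.smul_mem _ _ hx))
  simpa using mul_monomial_mem gA_mul_gT 1 0 hx

theorem gC_pow_mem (hq0 : q ≠ 0) {m : ℕ} (hm : 1 ≤ m) :
    gC q s 0 ^ m ∈ quantumIdeal F (gA q s 0) (gT q s) := by
  obtain ⟨c, -, e⟩ := gC_pow (s := s) hq0 m
  rw [e]
  exact Submodule.smul_mem _ _ (monomial_mem hm hm)

theorem gB_pow_mul_gC_pow_mem (hq0 : q ≠ 0) (hq1 : q - 1 ≠ 0) (n : ℕ) {m : ℕ} (hm : 1 ≤ m) :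
    gB q s 0 ^ n * gC q s 0 ^ m ∈ quantumIdeal F (gA q s 0) (gT q s) := by
  induction n with
  | zero => simpa using gC_pow_mem hq0 hm
  | succ n ih =>
    rw [pow_succ', mul_assoc]
    exact gB_mul_mem hq1 ih

theorem gC_pow_mul_gA_pow_mem (hq0 : q ≠ 0) {m : ℕ} (hm : 1 ≤ m) (k : ℕ) :
    gC q s 0 ^ m * gA q s 0 ^ k ∈ quantumIdeal F (gA q s 0) (gT q s) := by
  simpa using mul_monomial_mem gA_mul_gT 0 k (gC_pow_mem (s := s) hq0 hm)

/-- Every word is `A`, is `B`, or lies in the span of the monomials `T ^ i * A ^ j`, `i, j ≥ 1`. -/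
theorem lieWords_cases (hq0 : q ≠ 0) (hq1 : q - 1 ≠ 0) {x : U q s 0} (hx : x ∈ lieWords q s 0) :
    x = gA q s 0 ∨ x = gB q s 0 ∨ x ∈ quantumIdeal F (gA q s 0) (gT q s) := by
  rcases hx with ((rfl | rfl) | ⟨n, m, hm, rfl⟩) | ⟨m, k, hm, -, rfl⟩
  · exact Or.inl rfl
  · exact Or.inr (Or.inl rfl)
  · exact Or.inr (Or.inr (gB_pow_mul_gC_pow_mem hq0 hq1 n hm))
  · exact Or.inr (Or.inr (gC_pow_mul_gA_pow_mem hq0 hm k))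

theorem gT_pow_mul_gC_pow_mem_wordSpan (n : ℕ) {m : ℕ} (hm : 1 ≤ m) :
    gT q s ^ n * gC q s 0 ^ m ∈ wordSpan q s 0 := by
  -- The powers of `T` are polynomials in `B`; left multiplication by `T` preserves the span of
  -- the words `B ^ k * C ^ m` with `m` fixed.
  have key : gT q s ^ n * gC q s 0 ^ m ∈
      Submodule.span F (Set.range fun k : ℕ => gB q s 0 ^ k * gC q s 0 ^ m) := by
    induction n with
    | zero => exact Submodule.subset_span ⟨0, by simp⟩
    | succ n ih =>
      rw [pow_succ', mul_assoc]
      generalize gT q s ^ n * gC q s 0 ^ m = x at ih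
      induction ih using Submodule.span_induction with
      | mem x hx =>
        obtain ⟨k, rfl⟩ := hx
        simp only [gT, add_mul, smul_mul_assoc, one_mul]
        rw [← mul_assoc, ← pow_succ']
        exact add_mem (Submodule.smul_mem _ _ (Submodule.subset_span ⟨k + 1, rfl⟩))
          (Submodule.smul_mem _ _ (Submodule.subset_span ⟨k, rfl⟩))
      | zero => simp
      | add x y _ _ ihx ihy => rw [mul_add]; exact add_mem ihx ihy
      | smul c x _ ih => rw [mul_smul_comm]; exact Submodule.smul_mem _ _ ih
  refine Submodule.span_mono ?_ key
  rintro _ ⟨k, rfl⟩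
  exact Or.inl (Or.inr ⟨k, m, hm, rfl⟩)

theorem quantumIdeal_le_wordSpan (hq0 : q ≠ 0) :
    quantumIdeal F (gA q s 0) (gT q s) ≤ wordSpan q s 0 := by
  refine Submodule.span_le.2 ?_
  rintro _ ⟨i, j, hi, hj, rfl⟩
  rcases le_total j i with hij | hij
  · obtain ⟨d, rfl⟩ := Nat.exists_eq_add_of_le' hij
    obtain ⟨c, hc, e⟩ := gC_pow (s := s) hq0 j
    rw [pow_add, mul_assoc, (inv_smul_eq_iff₀ hc).2 e |>.symm, mul_smul_comm]
    exact Submodule.smul_mem _ _ (gT_pow_mul_gC_pow_mem_wordSpan d hj)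
  · obtain ⟨d, rfl⟩ := Nat.exists_eq_add_of_le hij
    obtain ⟨c, hc, e⟩ := gC_pow (s := s) hq0 i
    rw [pow_add, ← mul_assoc, (inv_smul_eq_iff₀ hc).2 e |>.symm, smul_mul_assoc]
    refine Submodule.smul_mem _ _ ?_
    rcases Nat.eq_zero_or_pos d with rfl | hd
    · simpa using gT_pow_mul_gC_pow_mem_wordSpan (q := q) (s := s) 0 hi
    · exact Submodule.subset_span (Or.inr ⟨i, d, hi, hd, rfl⟩)

theorem lie_mem_wordSpan (hq0 : q ≠ 0) (hq1 : q - 1 ≠ 0) {x y : U q s 0}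
    (hx : x ∈ wordSpan q s 0) (hy : y ∈ wordSpan q s 0) : ⁅x, y⁆ ∈ wordSpan q s 0 := by
  induction hx, hy using Submodule.span_induction₂ with
  | mem_mem x y hx hy =>
    have hC : gC q s 0 ∈ quantumIdeal F (gA q s 0) (gT q s) := by
      simpa using gC_pow_mem (q := q) (s := s) hq0 le_rfl
    apply quantumIdeal_le_wordSpan hq0
    rw [LieRing.of_associative_ring_bracket]
    rcases lieWords_cases hq0 hq1 hx with rfl | rfl | hx <;>
      rcases lieWords_cases hq0 hq1 hy with rfl | rfl | hy
    · simp
    · exact hC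
    · exact sub_mem (gA_mul_mem hy) (mul_gA_mem hy)
    · rw [← neg_sub]
      exact neg_mem hC
    · simp
    · exact sub_mem (gB_mul_mem hq1 hy) (mul_gB_mem hq1 hy)
    · exact sub_mem (mul_gA_mem hx) (gA_mul_mem hx)
    · exact sub_mem (mul_gB_mem hq1 hx) (gB_mul_mem hq1 hx)
    · exact sub_mem (quantumIdeal_mul_mem gA_mul_gT hx hy) (quantumIdeal_mul_mem gA_mul_gT hy hx)
  | zero_left y _ => simp
  | zero_right x _ => simp
  | add_left x y z _ _ _ hx hy => rw [add_lie]; exact add_mem hx hy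
  | add_right x y z _ _ _ hx hy => rw [lie_add]; exact add_mem hx hy
  | smul_left c x y _ _ h => rw [smul_lie]; exact Submodule.smul_mem _ _ h
  | smul_right c x y _ _ h => rw [lie_smul]; exact Submodule.smul_mem _ _ h

/-! ### The Lie subalgebra generated by `A` and `B` -/

theorem gA_mem_lieL (q r s : F) : gA q r s ∈ lieL q r s :=
  LieSubalgebra.subset_lieSpan (Or.inl rfl)

theorem gB_mem_lieL (q r s : F) : gB q r s ∈ lieL q r s :=
  LieSubalgebra.subset_lieSpan (Or.inr rfl)

/-- `T` itself need not lie in `L_(s,0)`, but it differs from a multiple of `B` by a scalar. -/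
theorem lie_gT_mem_lieL {x : U q s 0} (hx : x ∈ lieL q s 0) : ⁅gT q s, x⁆ ∈ lieL q s 0 := by
  have : ⁅gT q s, x⁆ = (q - 1) • ⁅gB q s 0, x⁆ := by
    simp only [LieRing.of_associative_ring_bracket, gT, add_mul, mul_add, smul_mul_assoc,
      mul_smul_comm, one_mul, mul_one]
    module
  rw [this]
  exact (lieL q s 0).smul_mem _ ((lieL q s 0).lie_mem (gB_mem_lieL q s 0) hx)

theorem monomial_mem_lieL (hq : ∀ n : ℕ, 1 ≤ n → q ^ n ≠ 1) (i j : ℕ) :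
    gT q s ^ (i + 1) * gA q s 0 ^ (j + 1) ∈ lieL q s 0 := by
  induction i with
  | zero =>
    induction j with
    | zero =>
      have := (lieL q s 0).lie_mem (gA_mem_lieL q s 0) (gB_mem_lieL q s 0)
      rw [LieRing.of_associative_ring_bracket, ← gC, gC_eq] at this
      simpa using this
    | succ j ih =>
      have e : ⁅gA q s 0, gT q s ^ (0 + 1) * gA q s 0 ^ (j + 1)⁆
          = (q - 1) • (gT q s ^ (0 + 1) * gA q s 0 ^ (j + 1 + 1)) := by
        have h₁ := monomial_mul_monomial (gA_mul_gT (q := q) (s := s)) 0 1 1 (j + 1)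
        have h₂ := monomial_mul_monomial (gA_mul_gT (q := q) (s := s)) 1 (j + 1) 0 1
        simp only [pow_zero, pow_one, one_mul, mul_one, mul_zero, zero_add, add_zero, one_smul]
          at h₁ h₂
        rw [LieRing.of_associative_ring_bracket, zero_add, pow_one, h₁, h₂, add_comm 1 (j + 1)]
        module
      have hc : q - 1 ≠ 0 := sub_ne_zero.2 (by simpa using hq 1 le_rfl)
      rw [(inv_smul_eq_iff₀ hc).2 e |>.symm]
      exact (lieL q s 0).smul_mem _ ((lieL q s 0).lie_mem (gA_mem_lieL q s 0) ih)
  | succ i ih =>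
    have e : ⁅gT q s, gT q s ^ (i + 1) * gA q s 0 ^ (j + 1)⁆
        = (1 - q ^ (j + 1)) • (gT q s ^ (i + 1 + 1) * gA q s 0 ^ (j + 1)) := by
      rw [LieRing.of_associative_ring_bracket, mul_assoc (gT q s ^ (i + 1)),
        pow_mul_of_qcomm (gA_mul_gT (q := q) (s := s)), mul_smul_comm, ← mul_assoc, ← mul_assoc, ← pow_succ,
        ← pow_succ']
      module
    have hc : 1 - q ^ (j + 1) ≠ 0 := sub_ne_zero.2 (hq (j + 1) (by lia)).symm
    rw [(inv_smul_eq_iff₀ hc).2 e |>.symm]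
    exact (lieL q s 0).smul_mem _ (lie_gT_mem_lieL ih)

theorem quantumIdeal_le_lieL (hq : ∀ n : ℕ, 1 ≤ n → q ^ n ≠ 1) :
    quantumIdeal F (gA q s 0) (gT q s) ≤ (lieL q s 0).toSubmodule := by
  refine Submodule.span_le.2 ?_
  rintro _ ⟨i, j, hi, hj, rfl⟩
  obtain ⟨i, rfl⟩ := Nat.exists_eq_add_of_le' hi
  obtain ⟨j, rfl⟩ := Nat.exists_eq_add_of_le' hj
  exact monomial_mem_lieL hq i j

theorem lieL_eq_wordSpan (hq0 : q ≠ 0) (hq : ∀ n : ℕ, 1 ≤ n → q ^ n ≠ 1) :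
    (lieL q s 0).toSubmodule = wordSpan q s 0 := by
  have hq1 : q - 1 ≠ 0 := sub_ne_zero.2 (by simpa using hq 1 le_rfl)
  apply le_antisymm
  · let W : LieSubalgebra F (U q s 0) :=
      { wordSpan q s 0 with lie_mem' := fun hx hy => lie_mem_wordSpan hq0 hq1 hx hy }
    have : lieL q s 0 ≤ W := LieSubalgebra.lieSpan_le.2 fun x hx =>
      Submodule.subset_span (Or.inl (Or.inl hx))
    exact this
  · refine Submodule.span_le.2 fun x hx => ?_
    rcases lieWords_cases hq0 hq1 hx with rfl | rfl | hx
    · exact gA_mem_lieL q s 0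
    · exact gB_mem_lieL q s 0
    · exact quantumIdeal_le_lieL hq hx

end Words

/-! ### The anti-isomorphism exchanging `A` and `B` -/

section Swap

open MulOpposite

variable {F : Type*} [Field F]

/-- The anti-homomorphism `U_q(r, s) → U_q(s, r)` with `A ↦ B` and `B ↦ A`, as a homomorphism to
the opposite algebra. -/
noncomputable def swapOp (q r s : F) : U q r s →ₐ[F] (U q s r)ᵐᵒᵖ :=
  RingQuot.liftAlgHom F ⟨FreeAlgebra.lift F fun
    | Letter.A => op (gB q s r)
    | Letter.B => op (gA q s r), by
      rintro _ _ ⟨⟩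
      simp only [map_sub, map_mul, map_smul, map_add, FreeAlgebra.lift_ι_apply]
      apply unop_injective
      simpa [add_comm] using gA_mul_gB q s r⟩

@[simp]
theorem swapOp_gA (q r s : F) : swapOp q r s (gA q r s) = op (gB q s r) := by
  simp [swapOp, gA]

@[simp]
theorem swapOp_gB (q r s : F) : swapOp q r s (gB q r s) = op (gA q s r) := by
  simp [swapOp, gB]

/-- The anti-homomorphism `U_q(r, s) → U_q(s, r)` with `A ↦ B` and `B ↦ A`, as a linear map. -/
noncomputable def swap (q r s : F) : U q r s →ₗ[F] U q s r :=
  (opLinearEquiv F).symm.toLinearMap ∘ₗ (swapOp q r s).toLinearMap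

theorem swap_apply (q r s : F) (x : U q r s) : swap q r s x = unop (swapOp q r s x) := rfl

@[simp]
theorem swap_gA (q r s : F) : swap q r s (gA q r s) = gB q s r := by
  simp [swap_apply]

@[simp]
theorem swap_gB (q r s : F) : swap q r s (gB q r s) = gA q s r := by
  simp [swap_apply]

@[simp]
theorem swap_mul (q r s : F) (x y : U q r s) :
    swap q r s (x * y) = swap q r s y * swap q r s x := by
  simp [swap_apply]

@[simp]
theorem swap_pow (q r s : F) (x : U q r s) (n : ℕ) :
    swap q r s (x ^ n) = swap q r s x ^ n := by
  simp [swap_apply]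

@[simp]
theorem swap_gC (q r s : F) : swap q r s (gC q r s) = gC q s r := by
  simp [gC]

@[simp]
theorem swap_swap (q r s : F) (x : U q r s) : swap q s r (swap q r s x) = x := by
  let f : U q r s →ₐ[F] U q r s := (AlgHom.opComm (swapOp q s r)).comp (swapOp q r s)
  have hf : f = AlgHom.id F _ := by
    apply RingQuot.ringQuot_ext'
    apply FreeAlgebra.hom_ext
    funext l
    cases l
    · change f (gA q r s) = gA q r s
      simp [f, AlgHom.opComm]
    · change f (gB q r s) = gB q r s
      simp [f, AlgHom.opComm]
  exact congrArg (fun g : U q r s →ₐ[F] U q r s => g x) hf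

/-- The negative of an anti-isomorphism is an isomorphism of the commutator Lie algebras. -/
noncomputable def negSwap (q r s : F) : U q r s ≃ₗ⁅F⁆ U q s r where
  toLinearMap := -swap q r s
  map_lie' := by
    intro x y
    have h : swap q r s ⁅x, y⁆ = swap q r s y * swap q r s x - swap q r s x * swap q r s y := by
      rw [LieRing.of_associative_ring_bracket, map_sub, swap_mul, swap_mul]
    exact (congrArg (- ·) h).trans <| (neg_sub _ _).trans <|
      congrArg₂ (· - ·) (neg_mul_neg (swap q r s x) (swap q r s y)).symm
        (neg_mul_neg (swap q r s y) (swap q r s x)).symm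
  invFun := -swap q s r
  left_inv x := by simp
  right_inv x := by simp

@[simp]
theorem negSwap_apply (q r s : F) (x : U q r s) : negSwap q r s x = -swap q r s x := rfl

theorem swap_mem_lieWords (q r s : F) {x : U q r s} (hx : x ∈ lieWords q r s) :
    swap q r s x ∈ lieWords q s r := by
  rcases hx with ((rfl | rfl) | ⟨n, m, hm, rfl⟩) | ⟨m, k, hm, -, rfl⟩
  · exact Or.inl (Or.inl (Or.inr (swap_gA q r s)))
  · exact Or.inl (Or.inl (Or.inl (swap_gB q r s)))
  · rcases Nat.eq_zero_or_pos n with rfl | hn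
    · exact Or.inl (Or.inr ⟨0, m, hm, by simp⟩)
    · exact Or.inr ⟨m, n, hm, hn, by simp⟩
  · exact Or.inl (Or.inr ⟨k, m, hm, by simp⟩)

theorem negSwap_mem_wordSpan (q r s : F) {x : U q r s} (hx : x ∈ wordSpan q r s) :
    negSwap q r s x ∈ wordSpan q s r := by
  have h : wordSpan q r s ≤ (wordSpan q s r).comap (swap q r s) :=
    Submodule.span_le.2 fun y hy => Submodule.subset_span (swap_mem_lieWords q r s hy)
  exact neg_mem (h hx)

theorem map_negSwap_lieL {q s : F} (h : (lieL q s 0).toSubmodule = wordSpan q s 0) :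
    ((lieL q s 0).map (negSwap q s 0).toLieHom).toSubmodule = wordSpan q 0 s := by
  ext y
  constructor
  · rintro ⟨x, hx, rfl⟩
    exact negSwap_mem_wordSpan q s 0 (h.le hx)
  · intro hy
    exact ⟨negSwap q 0 s y, h.ge (negSwap_mem_wordSpan q 0 s hy), by simp⟩

end Swap

/-! ### Uniqueness -/

/-- The prescribed values determine a linear map, because the words span. -/
theorem HasPsiValues.unique {F : Type*} [Field F] {q s : F} {K : LieSubalgebra F (U q 0 s)}
    (h : (lieL q s 0).toSubmodule = wordSpan q s 0) {Φ Ψ : lieL q s 0 →ₗ[F] K}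
    (hΦ : HasPsiValues Φ) (hΨ : HasPsiValues Ψ) : Φ = Ψ := by
  have key : ∀ x (hx : x ∈ wordSpan q s 0), Φ ⟨x, h.ge hx⟩ = Ψ ⟨x, h.ge hx⟩ := by
    intro x hx
    induction hx using Submodule.span_induction with
    | mem x hx =>
      apply Subtype.ext
      rcases hx with ((hx | hx) | ⟨n, m, hm, hx⟩) | ⟨m, k, hm, hk, hx⟩
      · rw [hΦ.map_A _ hx, hΨ.map_A _ hx]
      · rw [Set.mem_singleton_iff] at hx
        rw [hΦ.map_B _ hx, hΨ.map_B _ hx]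
      · rcases Nat.eq_zero_or_pos n with rfl | hn
        · rw [pow_zero, one_mul] at hx
          rw [hΦ.map_C m hm _ hx, hΨ.map_C m hm _ hx]
        · rw [hΦ.map_BC m n hm hn _ hx, hΨ.map_BC m n hm hn _ hx]
      · rw [hΦ.map_CA m k hm hk _ hx, hΨ.map_CA m k hm hk _ hx]
    | zero => exact (map_zero Φ).trans (map_zero Ψ).symm
    | add x y hx hy ihx ihy =>
      have := congrArg₂ (· + ·) ihx ihy
      simp only [← map_add] at this
      exact this
    | smul c x hx ih =>
      have := congrArg (c • ·) ih
      simp only [← map_smul] at this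
      exact this
  exact LinearMap.ext fun x => key x (h.le x.2)

end QDeformed

theorem theorem7 {F : Type*} [Field F] [CharZero F] (q s : F) (hq0 : q ≠ 0)
    (hq : ∀ n : ℕ, 1 ≤ n → q ^ n ≠ 1) (hs : s ≠ 0) :
    (QDeformed.lieL q s 0).toSubmodule = QDeformed.wordSpan q s 0 ∧
    ∃ K : LieSubalgebra F (QDeformed.U q 0 s),
      K.toSubmodule = QDeformed.wordSpan q 0 s ∧
      ∃ Ψ : QDeformed.lieL q s 0 ≃ₗ⁅F⁆ K,
        QDeformed.HasPsiValues (Ψ.toLinearEquiv : QDeformed.lieL q s 0 →ₗ[F] K) ∧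
        ∀ Φ : QDeformed.lieL q s 0 →ₗ[F] K,
          QDeformed.HasPsiValues Φ → Φ = (Ψ.toLinearEquiv : QDeformed.lieL q s 0 →ₗ[F] K) := by
  have h := QDeformed.lieL_eq_wordSpan (s := s) hq0 hq
  let e := QDeformed.negSwap q s 0
  let Ψ := e.lieSubalgebraMap (QDeformed.lieL q s 0)
  have hval : ∀ x, (Ψ x : QDeformed.U q 0 s) = -QDeformed.swap q s 0 x := fun _ => rfl
  have hΨ : QDeformed.HasPsiValues
      (Ψ.toLinearEquiv : QDeformed.lieL q s 0 →ₗ[F] (QDeformed.lieL q s 0).map e.toLieHom) :=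
    { map_A := fun x hx => (hval x).trans (by simp [hx])
      map_B := fun x hx => (hval x).trans (by simp [hx])
      map_C := fun n _ x hx => (hval x).trans (by simp [hx])
      map_CA := fun u v _ _ x hx => (hval x).trans (by simp [hx])
      map_BC := fun u v _ _ x hx => (hval x).trans (by simp [hx]) }
  exact ⟨h, _, QDeformed.map_negSwap_lieL h, Ψ, hΨ, fun Φ hΦ => hΦ.unique h hΨ⟩
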